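/- For a finite simple graph $G=(V,E)$, let $S(G)$ be the set of all real symmetric matrices $A=(a_{ij})$ with rows and columns indexed by $V$ such that, for all $i\neq j$, $a_{ij}\neq 0$ if and only if $\{i,j\}\in E$ (the diagonal entries are arbitrary). For a square matrix $A$ let $q(A)$ be the number of distinct eigenvalues of $A$, and let $q(G)=\min\{q(A) : A\in S(G)\}$. A vertex of a graph is called pendant if it has exactly one neighbour, and $P_m$ denotes the path on $m$ vertices. Let $T$ be a finite tree. If $q(T)=|V(T)|-1$, then $T$ consists of a path $P_{|V(T)|-1}$ together with one pendant vertex adjacent to a non-pendant vertex of this path. That is, $T$ has a pendant vertex $v$ such that $T-v$ is a path on $|V(T)|-1$ vertices and the unique neighbour $w$ of $v$ in $T$ is not a pendant vertex of the path $T-v$. -/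

import Mathlib

namespace DistinctEigenvalues

/-- `S(G)`: the real symmetric matrices, with rows and columns indexed by the vertices of `G`,
whose off-diagonal entry at `(i, j)` is nonzero exactly when `i` and `j` are adjacent. The
diagonal entries are arbitrary. -/
def matrixClass {V : Type*} (G : SimpleGraph V) : Set (Matrix V V ℝ) :=
  {A | A.IsSymm ∧ ∀ i j : V, i ≠ j → (A i j ≠ 0 ↔ G.Adj i j)}

/-- `q(A)`: the number of distinct eigenvalues of a real square matrix. (It is only used for
symmetric matrices, all of whose eigenvalues are real.) -/
noncomputable def numEigenvalues {V : Type*} [Fintype V] [DecidableEq V]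
    (A : Matrix V V ℝ) : ℕ :=
  (spectrum ℝ A).ncard

/-- `q(G)`: the minimum of `q(A)` over all `A ∈ S(G)`. -/
noncomputable def q {V : Type*} [Fintype V] [DecidableEq V] (G : SimpleGraph V) : ℕ :=
  sInf (numEigenvalues '' matrixClass G)

/-- A pendant vertex is a vertex with exactly one neighbour. -/
def IsPendant {V : Type*} (G : SimpleGraph V) (v : V) : Prop :=
  (G.neighborSet v).ncard = 1

end DistinctEigenvalues

/-!
A tree `T` on `n` vertices with `q(T) = n - 1` is a path with one extra leaf at an interior vertex.
Eigenspaces of different eigenvalues are independent, so a matrix of `T` with an eigenvalue of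
multiplicity three, or with two eigenvalues of multiplicity two, has at most `n - 2` distinct
eigenvalues. Such matrices exist for every tree other than the paths and the trees of the asserted
form, while every matrix of a path has `n` distinct eigenvalues.

Multiplicity is produced by the branches at a vertex `u`, the components of `T - u`: if all `k` of
them have an eigenvector for `μ`, then the combinations of these `k` vectors, extended by zero,
which also satisfy the equation in row `u` form a space of eigenvectors of dimension at least
`k - 1` (`ncard_neighborSet_le_finrank_add_one`). There are three constructions.

* If `u` has degree at least four, every branch is shifted to have the eigenvalue `0`
  (`exists_numEigenvalues_add_two_le_of_four_le`).
* If `u` has degree at least three and no neighbour of `u` is a leaf, then the adjacency matrix of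
  each branch is not scalar, so it has two eigenvalues, which an affine change moves to `0` and `1`
  (`exists_numEigenvalues_add_two_le_of_no_pendant`).
* If `u ≠ v` both have degree at least three, the branches at `u` away from `v` are shifted to have
  the eigenvalue `L` and those at `v` away from `u` to have `-L`. For large `L` the rest of the
  matrix minus `±L` is diagonally dominant, so the diagonal entries at `v` and `u` can be chosen to
  give the eigenvalue `L` to the remaining branch at `u` and `-L` to the one at `v`
  (`exists_diagonal_entry`, `exists_numEigenvalues_add_two_le_of_two_branching`).

Hence `T` has at most one vertex of degree three or more. A tree of maximum degree two is a path
(`exists_isPathNumbering`), and an eigenvector of a matrix of a path is determined by its entry at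
one end, so the eigenvalues are simple (`IsPathNumbering.numEigenvalues_eq`). So exactly one vertex
`u` has degree greater than two, its degree is three, and one of its neighbours is a leaf; deleting
this leaf leaves a tree of maximum degree two in which `u` has degree two.
-/

namespace DistinctEigenvalues

open Matrix Module

/-! ### Eigenvectors of principal submatrices, extended by zero -/

lemma mulVec_extend_zero {V : Type*} [Fintype V] (B : Matrix V V ℝ) (s : Set V) [Fintype s]
    (z : s → ℝ) (y : s) :
    (B *ᵥ Function.extend Subtype.val z 0) y = (B.submatrix Subtype.val Subtype.val *ᵥ z) y := by
  classical
  simp only [mulVec, dotProduct, submatrix_apply]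
  rw [← Fintype.sum_subtype_add_sum_subtype (fun y => y ∈ s)
    (fun i => B y i * Function.extend Subtype.val z 0 i)]
  have h0 : ∑ i : {x // x ∉ s}, B y i * Function.extend Subtype.val z 0 (i : V) = 0 := by
    refine Finset.sum_eq_zero fun x _ => ?_
    rw [Function.extend_apply' _ _ _ fun ⟨a, ha⟩ => x.2 (ha ▸ a.2)]
    simp
  rw [h0, add_zero]
  have h1 : ∑ x : s, B y x * Function.extend Subtype.val z 0 (x : V) = ∑ x : s, B y x * z x :=
    Finset.sum_congr rfl fun x _ => by rw [Subtype.val_injective.extend_apply]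
  convert h1

lemma extend_zero_of_notMem {α : Type*} {s : Set α} (z : s → ℝ) {y : α} (hy : y ∉ s) :
    Function.extend Subtype.val z 0 y = 0 :=
  Function.extend_apply' _ _ _ (by rintro ⟨a, rfl⟩; exact hy a.2)

lemma exists_extend_zero {V : Type*} [Fintype V] (B : Matrix V V ℝ) (s : Set V) [Fintype s]
    {z : s → ℝ} (hz : z ≠ 0)
    {β : ℝ} (h : B.submatrix Subtype.val Subtype.val *ᵥ z = β • z) :
    ∃ x : V → ℝ, x ≠ 0 ∧ (∀ y ∉ s, x y = 0) ∧ ∀ y ∈ s, (B *ᵥ x) y = β * x y := by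
  refine ⟨Function.extend Subtype.val z 0, fun h0 => hz ?_, fun y hy => extend_zero_of_notMem z hy,
    fun y hy => ?_⟩
  · ext y
    rw [← Subtype.val_injective.extend_apply z 0 y, h0]
    rfl
  · have := mulVec_extend_zero B s z ⟨y, hy⟩
    rw [this, h, Pi.smul_apply, smul_eq_mul, ← Subtype.val_injective.extend_apply z 0 ⟨y, hy⟩]

/-- The principal submatrix of `B` on `s` has an eigenvector, here extended by zero; the eigenvalue
equation holds only in the rows in `s`. -/
lemma exists_eigenvector_on {V : Type*} [Fintype V] {B : Matrix V V ℝ} (hB : B.IsSymm) {s : Set V}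
    (hs : s.Nonempty) :
    ∃ β : ℝ, ∃ x : V → ℝ, x ≠ 0 ∧ (∀ y ∉ s, x y = 0) ∧ ∀ y ∈ s, (B *ᵥ x) y = β * x y := by
  classical
  obtain ⟨a, ha⟩ := hs
  have hH : (B.submatrix Subtype.val Subtype.val : Matrix s s ℝ).IsHermitian := by
    rw [Matrix.IsHermitian, conjTranspose_eq_transpose_of_trivial]
    exact hB.submatrix _
  refine ⟨hH.eigenvalues ⟨a, ha⟩, exists_extend_zero B s ?_ (hH.mulVec_eigenvectorBasis ⟨a, ha⟩)⟩
  intro h0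
  exact hH.eigenvectorBasis.orthonormal.ne_zero ⟨a, ha⟩ (by ext i; exact congrFun h0 i)

/-- A symmetric matrix on `s` with a nonzero off-diagonal entry is not scalar, so it has two
distinct eigenvalues. -/
lemma exists_two_eigenvectors_on {V : Type*} [Fintype V] {B : Matrix V V ℝ} (hB : B.IsSymm)
    {s : Set V} {a b : V}
    (ha : a ∈ s) (hb : b ∈ s) (hab : a ≠ b) (h : B a b ≠ 0) :
    ∃ β γ : ℝ, β ≠ γ ∧
      (∃ x : V → ℝ, x ≠ 0 ∧ (∀ y ∉ s, x y = 0) ∧ ∀ y ∈ s, (B *ᵥ x) y = β * x y) ∧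
      ∃ x : V → ℝ, x ≠ 0 ∧ (∀ y ∉ s, x y = 0) ∧ ∀ y ∈ s, (B *ᵥ x) y = γ * x y := by
  classical
  obtain ⟨β, hβ⟩ := exists_eigenvector_on hB ⟨a, ha⟩
  have hH : (B.submatrix Subtype.val Subtype.val - β • 1 : Matrix s s ℝ).IsHermitian := by
    rw [Matrix.IsHermitian, conjTranspose_eq_transpose_of_trivial]
    exact (hB.submatrix _).sub (Matrix.isSymm_one.smul β)
  obtain ⟨z, t, ht, hz, hzt⟩ := hH.exists_eigenvector_of_ne_zero (by
    intro h0
    have := congrFun (congrFun h0 ⟨a, ha⟩) ⟨b, hb⟩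
    simp [hab] at this
    exact h this)
  refine ⟨β, β + t, by simpa using ht, hβ, exists_extend_zero B s hz ?_⟩
  rw [sub_mulVec, smul_mulVec, one_mulVec, sub_eq_iff_eq_add] at hzt
  rw [hzt, add_smul, add_comm]

/-- If `B - μ` is strictly diagonally dominant on the rows in `s`, the eigenvalue equations for `μ`
in those rows have a solution supported on `s ∪ {v}` with prescribed value `1` at `v`. -/
lemma exists_eigenvector_on_of_dominant {V : Type*} [Fintype V] [DecidableEq V] (B : Matrix V V ℝ)
    (μ : ℝ) (s : Set V) {v : V} (hv : v ∉ s)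
    (h : ∀ y ∈ s, ∑ z ∈ Finset.univ.erase y, |B y z| < |B y y - μ|) :
    ∃ x : V → ℝ, x v = 1 ∧ (∀ y ∉ s, y ≠ v → x y = 0) ∧ ∀ y ∈ s, (B *ᵥ x) y = μ * x y := by
  classical
  set M : Matrix s s ℝ := B.submatrix Subtype.val Subtype.val - μ • 1 with hM
  have hdet : M.det ≠ 0 := by
    refine det_ne_zero_of_sum_row_lt_diag fun k => ?_
    have hk : M k k = B k k - μ := by simp [hM]
    rw [hk, Real.norm_eq_abs]
    refine lt_of_le_of_lt ?_ (h k k.2)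
    calc ∑ j ∈ Finset.univ.erase k, ‖M k j‖
        = ∑ j ∈ (Finset.univ.erase k).map (Function.Embedding.subtype _), |B k j| := by
          rw [Finset.sum_map]
          refine Finset.sum_congr rfl fun j hj => ?_
          simp [hM, (Finset.ne_of_mem_erase hj).symm]
      _ ≤ _ := by
          refine Finset.sum_le_sum_of_subset_of_nonneg ?_ fun _ _ _ => abs_nonneg _
          intro z hz
          simp only [Finset.mem_map, Finset.mem_erase, Finset.mem_univ, and_true] at hz ⊢
          obtain ⟨j, hj, rfl⟩ := hz
          exact fun e => hj (Subtype.ext e)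
  set z : s → ℝ := M⁻¹ *ᵥ (fun y => - B y v) with hz
  have hMz : M *ᵥ z = fun y : s => - B y v := by
    rw [hz, mulVec_mulVec, mul_nonsing_inv _ (isUnit_iff_ne_zero.2 hdet), one_mulVec]
  refine ⟨Function.extend Subtype.val z 0 + Pi.single v 1, ?_, fun y hy hyv => ?_, fun y hy => ?_⟩
  · simp [extend_zero_of_notMem z hv]
  · simp [extend_zero_of_notMem z hy, hyv]
  · have hyv : y ≠ v := fun e => hv (e ▸ hy)
    have h1 := mulVec_extend_zero B s z ⟨y, hy⟩
    have h2 := congrFun hMz ⟨y, hy⟩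
    rw [hM, sub_mulVec, smul_mulVec, one_mulVec] at h2
    simp only [Pi.sub_apply, Pi.smul_apply, smul_eq_mul] at h2
    have h3 := Subtype.val_injective.extend_apply z 0 ⟨y, hy⟩
    simp only at h1 h3
    rw [mulVec_add, Pi.add_apply, Pi.add_apply, h1, mulVec_single_one, h3, Pi.single_eq_of_ne hyv,
      col_apply]
    linarith

/-! ### Counting eigenvalues -/

/-- Each eigenvalue in `s` uses up its multiplicity in the total dimension, while contributing only
one to the number of distinct eigenvalues. -/
lemma numEigenvalues_add_sum_le {V : Type*} [Fintype V] [DecidableEq V] (A : Matrix V V ℝ)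
    (s : Finset ℝ)
    (hs : ∀ μ ∈ s, 1 ≤ finrank ℝ (End.eigenspace A.toLin' μ)) :
    numEigenvalues A + ∑ μ ∈ s, (finrank ℝ (End.eigenspace A.toLin' μ) - 1) ≤ Fintype.card V := by
  have hfin : (spectrum ℝ A).Finite := by
    rw [← Matrix.spectrum_toLin']
    exact Module.End.finite_spectrum _
  set S := hfin.toFinset with hS
  have hmem : ∀ μ, μ ∈ S ↔ 1 ≤ finrank ℝ (End.eigenspace A.toLin' μ) := by
    intro μ
    rw [hS, Set.Finite.mem_toFinset, ← Matrix.spectrum_toLin', ← End.hasEigenvalue_iff_mem_spectrum,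
      End.hasEigenvalue_iff, Nat.one_le_iff_ne_zero, ne_eq, ne_eq, Submodule.finrank_eq_zero]
  have hcard : numEigenvalues A = ∑ μ ∈ S, 1 := by
    rw [numEigenvalues, Set.ncard_eq_toFinset_card _ hfin, Finset.sum_const, smul_eq_mul, mul_one]
  have hsS : s ⊆ S := fun μ hμ => (hmem μ).2 (hs μ hμ)
  calc numEigenvalues A + ∑ μ ∈ s, (finrank ℝ (End.eigenspace A.toLin' μ) - 1)
      ≤ ∑ μ ∈ S, 1 + ∑ μ ∈ S, (finrank ℝ (End.eigenspace A.toLin' μ) - 1) := by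
        rw [hcard]
        gcongr
    _ = ∑ μ ∈ S, finrank ℝ (End.eigenspace A.toLin' μ) := by
        rw [← Finset.sum_add_distrib]
        refine Finset.sum_congr rfl fun μ hμ => ?_
        have := (hmem μ).1 hμ
        omega
    _ = ∑ μ : S, finrank ℝ (End.eigenspace A.toLin' (μ : ℝ)) := (Finset.sum_coe_sort S _).symm
    _ ≤ Fintype.card V := by
        have hind : iSupIndep fun μ : S => End.eigenspace A.toLin' (μ : ℝ) :=
          (End.eigenspaces_iSupIndep A.toLin').comp Subtype.val_injective
        rw [← Module.finrank_fintype_fun_eq_card ℝ, ← Module.finrank_directSum]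
        exact LinearMap.finrank_le_finrank_of_injective hind.dfinsupp_lsum_injective

lemma numEigenvalues_add_two_le_of_three_le_finrank {V : Type*} [Fintype V] [DecidableEq V]
    (A : Matrix V V ℝ) (μ : ℝ)
    (h : 3 ≤ finrank ℝ (End.eigenspace A.toLin' μ)) :
    numEigenvalues A + 2 ≤ Fintype.card V := by
  have := numEigenvalues_add_sum_le A {μ} fun ν hν => by
    rw [Finset.mem_singleton.1 hν]; omega
  rw [Finset.sum_singleton] at this
  omega

lemma numEigenvalues_add_two_le_of_two_le_finrank {V : Type*} [Fintype V] [DecidableEq V]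
    (A : Matrix V V ℝ) {μ ν : ℝ} (hne : μ ≠ ν)
    (hμ : 2 ≤ finrank ℝ (End.eigenspace A.toLin' μ))
    (hν : 2 ≤ finrank ℝ (End.eigenspace A.toLin' ν)) :
    numEigenvalues A + 2 ≤ Fintype.card V := by
  have := numEigenvalues_add_sum_le A {μ, ν} fun κ hκ => by
    rcases Finset.mem_insert.1 hκ with rfl | hκ
    · omega
    · rw [Finset.mem_singleton.1 hκ]; omega
  rw [Finset.sum_pair hne] at this
  omega

/-! ### Branches of a tree at a vertex -/

/-- The branch at `u` containing `c`: the component of `c` after deletion of all edges at `u`. For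
`c ≠ u` this is the vertex set of the component of `T - u` that contains `c`. -/
def branch {V : Type*} (T : SimpleGraph V) (u c : V) : Set V :=
  ((T.deleteIncidenceSet u).connectedComponentMk c).supp

lemma mem_branch {V : Type*} {T : SimpleGraph V} {u c y : V} :
    y ∈ branch T u c ↔ (T.deleteIncidenceSet u).connectedComponentMk y =
      (T.deleteIncidenceSet u).connectedComponentMk c := Iff.rfl

lemma self_mem_branch {V : Type*} (T : SimpleGraph V) (u c : V) : c ∈ branch T u c := rfl

lemma mk_eq_of_adj {V : Type*} {T : SimpleGraph V} {u y z : V} (h : T.Adj y z)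
    (hy : y ≠ u) (hz : z ≠ u) :
    (T.deleteIncidenceSet u).connectedComponentMk y =
      (T.deleteIncidenceSet u).connectedComponentMk z :=
  SimpleGraph.ConnectedComponent.sound
    (SimpleGraph.deleteIncidenceSet_adj.2 ⟨h, hy, hz⟩).reachable

lemma ne_of_mem_branch {V : Type*} {T : SimpleGraph V} {u c y : V} (hc : c ≠ u)
    (hy : y ∈ branch T u c) : y ≠ u := by
  rintro rfl
  obtain ⟨p⟩ := SimpleGraph.ConnectedComponent.exact hy
  cases p with
  | nil => exact hc rfl
  | cons h p => exact (SimpleGraph.deleteIncidenceSet_adj.1 h).2.1 rfl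

/-- In a forest, distinct neighbours of `u` lie in distinct branches, because each edge at `u` is a
bridge. -/
lemma eq_of_mem_branch {V : Type*} {T : SimpleGraph V} (hT : T.IsAcyclic) {u c c' y : V}
    (hc : T.Adj u c) (hc' : T.Adj u c') (h : y ∈ branch T u c) (h' : y ∈ branch T u c') :
    c = c' := by
  by_contra hne
  have hb := SimpleGraph.isAcyclic_iff_forall_adj_isBridge.1 hT hc
  rw [SimpleGraph.isBridge_iff] at hb
  refine hb ?_
  have hreach : (T.deleteIncidenceSet u).Reachable c' c :=
    SimpleGraph.ConnectedComponent.exact (h'.symm.trans h)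
  have hle : T.deleteIncidenceSet u ≤ T.deleteEdges {s(u, c)} := by
    intro a b hab
    rw [SimpleGraph.deleteIncidenceSet_adj] at hab
    rw [SimpleGraph.deleteEdges_adj]
    refine ⟨hab.1, fun he => ?_⟩
    rw [Set.mem_singleton_iff, Sym2.eq_iff] at he
    rcases he with he | he
    · exact hab.2.1 he.1
    · exact hab.2.2 he.2
  refine SimpleGraph.Reachable.trans (SimpleGraph.Adj.reachable ?_) (hreach.mono hle)
  rw [SimpleGraph.deleteEdges_adj]
  refine ⟨hc', fun he => ?_⟩
  rw [Set.mem_singleton_iff, Sym2.eq_iff] at he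
  rcases he with he | he
  · exact hne he.2.symm
  · exact hc.ne he.1

/-- In a connected graph, every vertex other than `u` and `v` can reach `v` avoiding `u` or reach
`u` avoiding `v`. -/
lemma mem_branch_or_mem_branch {V : Type*} {T : SimpleGraph V} (hT : T.Connected) {u v y : V}
    (huv : u ≠ v) (hu : y ≠ u) (hv : y ≠ v) : v ∈ branch T u y ∨ u ∈ branch T v y := by
  obtain ⟨p⟩ := hT.preconnected y v
  induction p with
  | nil => exact absurd rfl hv
  | @cons a b w hab p ih =>
    by_cases hbw : b = w
    · subst hbw
      exact Or.inl (mk_eq_of_adj hab hu huv.symm).symm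
    by_cases hbu : b = u
    · subst hbu
      exact Or.inr (mk_eq_of_adj hab hv huv).symm
    · rcases ih huv hbu hbw with h | h
      · exact Or.inl (h.trans (mk_eq_of_adj hab hu hbu).symm)
      · exact Or.inr (h.trans (mk_eq_of_adj hab hv hbw).symm)

/-- `x` is a nonzero vector supported on the branch at `u` containing `c` and satisfies the
eigenvalue equation of `A` for `μ` in every row except possibly row `u`. -/
structure IsBranchVector {V : Type*} [Fintype V] (T : SimpleGraph V) (A : Matrix V V ℝ) (u c : V)
    (μ : ℝ)
    (x : V → ℝ) : Prop where
  ne_zero : x ≠ 0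
  eq_zero : ∀ y ∉ branch T u c, x y = 0
  mulVec_apply : ∀ y ≠ u, (A *ᵥ x) y = μ * x y

/-- Vectors on different branches are independent, and a combination of them is an eigenvector as
soon as it satisfies the single remaining equation, the one in row `u`. -/
lemma ncard_neighborSet_le_finrank_add_one {V : Type*} [Fintype V] [DecidableEq V]
    {T : SimpleGraph V} (hT : T.IsAcyclic)
    (A : Matrix V V ℝ) (u : V) (μ : ℝ) (h : ∀ c, T.Adj u c → ∃ x, IsBranchVector T A u c μ x) :
    (T.neighborSet u).ncard ≤ finrank ℝ (End.eigenspace A.toLin' μ) + 1 := by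
  classical
  choose! x hx using h
  set N := T.neighborSet u
  have hxu : ∀ c : N, x c u = 0 := fun c =>
    (hx c c.2).eq_zero u fun hu => ne_of_mem_branch (T.ne_of_adj c.2).symm hu rfl
  have hind : LinearIndependent ℝ fun c : N => x c := by
    rw [Fintype.linearIndependent_iff]
    intro g hg c
    obtain ⟨y, hy⟩ := Function.ne_iff.1 (hx c c.2).ne_zero
    have hyc : y ∈ branch T u c := by
      by_contra hyc
      exact hy ((hx c c.2).eq_zero y hyc)
    have := congrFun hg y
    rw [Finset.sum_apply, Finset.sum_eq_single c] at this
    · exact (mul_eq_zero.1 this).resolve_right hy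
    · intro c' _ hne
      rw [Pi.smul_apply, (hx c' c'.2).eq_zero y, smul_zero]
      exact fun hy' => hne (Subtype.ext (eq_of_mem_branch hT c'.2 c.2 hy' hyc))
    · simp
  set Φ : (N → ℝ) →ₗ[ℝ] (V → ℝ) := Fintype.linearCombination ℝ fun c : N => x c with hΦ
  have hΦinj : Function.Injective Φ := LinearIndependent.fintypeLinearCombination_injective hind
  set ψ : (N → ℝ) →ₗ[ℝ] ℝ := (LinearMap.proj u).comp (A.toLin'.comp Φ) with hψ
  have hmem : ∀ t : LinearMap.ker ψ, Φ t ∈ End.eigenspace A.toLin' μ := by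
    rintro ⟨t, ht⟩
    rw [End.mem_eigenspace_iff]
    ext y
    by_cases hy : y = u
    · subst hy
      have h1 : A.toLin' (Φ t) y = 0 := ht
      rw [h1, Pi.smul_apply, hΦ, Fintype.linearCombination_apply, Finset.sum_apply,
        Finset.sum_eq_zero, smul_zero]
      intro c _
      rw [Pi.smul_apply, hxu, smul_zero]
    · rw [hΦ, Fintype.linearCombination_apply, map_sum, Finset.sum_apply, Pi.smul_apply,
        Finset.sum_apply, Finset.smul_sum]
      refine Finset.sum_congr rfl fun c _ => ?_
      rw [map_smul, Pi.smul_apply, toLin'_apply, (hx c c.2).mulVec_apply y hy, Pi.smul_apply,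
        smul_eq_mul, smul_eq_mul, smul_eq_mul]
      ring
  have h1 : finrank ℝ (LinearMap.ker ψ) ≤ finrank ℝ (End.eigenspace A.toLin' μ) :=
    LinearMap.finrank_le_finrank_of_injective
      (f := (Φ.domRestrict (LinearMap.ker ψ)).codRestrict _ hmem) fun a b hab =>
        Subtype.ext (hΦinj (congrArg Subtype.val hab))
  have h2 := ψ.finrank_range_add_finrank_ker
  have h3 := (LinearMap.range ψ).finrank_le
  rw [Module.finrank_fintype_fun_eq_card] at h2
  rw [Module.finrank_self] at h3
  rw [Set.ncard_eq_toFinset_card', Set.toFinset_card]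
  omega

open Classical in
lemma adjMatrix_mulVec_eq_zero {V : Type*} [Fintype V] {T : SimpleGraph V} {u c y : V} (hc : c ≠ u)
    {x : V → ℝ} (hx : ∀ y ∉ branch T u c, x y = 0) (hy : y ∉ branch T u c) (hyu : y ≠ u) :
    (T.adjMatrix ℝ *ᵥ x) y = 0 := by
  rw [SimpleGraph.adjMatrix_mulVec_apply]
  refine Finset.sum_eq_zero fun z hz => hx z fun hzc => hy ?_
  rw [SimpleGraph.mem_neighborFinset] at hz
  exact (mk_eq_of_adj hz hyu (ne_of_mem_branch hc hzc)).trans hzc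

/-! ### Rescaling and shifting the branches at one vertex -/

open Classical in
/-- The matrix obtained from the adjacency matrix of `T` by replacing the principal submatrix `B` on
each component `K` of `T - u` by `s K • B + t K • 1`, and the diagonal entry at `u` by the value of
`t` at the component `{u}` of the graph without the edges at `u`. -/
noncomputable def branchMatrix {V : Type*} [DecidableEq V] (T : SimpleGraph V) (u : V)
    (s t : (T.deleteIncidenceSet u).ConnectedComponent → ℝ) : Matrix V V ℝ :=
  Matrix.of fun y z =>
    if y = z then t ((T.deleteIncidenceSet u).connectedComponentMk y)
    else if T.Adj y z then
      if y = u ∨ z = u then 1 else s ((T.deleteIncidenceSet u).connectedComponentMk y)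
    else 0

lemma branchMatrix_mem_matrixClass {V : Type*} [DecidableEq V] (T : SimpleGraph V) (u : V)
    {s : (T.deleteIncidenceSet u).ConnectedComponent → ℝ} (hs : ∀ K, s K ≠ 0)
    (t : (T.deleteIncidenceSet u).ConnectedComponent → ℝ) :
    branchMatrix T u s t ∈ matrixClass T := by
  refine ⟨?_, fun i j hij => ?_⟩
  · ext i j
    simp only [Matrix.transpose_apply, branchMatrix, Matrix.of_apply]
    by_cases hij : i = j
    · subst hij; rfl
    rw [if_neg hij, if_neg (Ne.symm hij)]
    by_cases ha : T.Adj i j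
    · rw [if_pos ha, if_pos ha.symm]
      by_cases hu : i = u ∨ j = u
      · rw [if_pos hu, if_pos hu.symm]
      · rw [if_neg hu, if_neg (fun h => hu h.symm)]
        rw [not_or] at hu
        rw [mk_eq_of_adj ha hu.1 hu.2]
    · rw [if_neg ha, if_neg (fun h => ha h.symm)]
  · simp only [branchMatrix, Matrix.of_apply, if_neg hij]
    split_ifs with h1 h2 <;> simp [h1, hs]

open Classical in
lemma isBranchVector_branchMatrix {V : Type*} [Fintype V] [DecidableEq V] {T : SimpleGraph V}
    {u c : V} (hc : c ≠ u)
    (s t : (T.deleteIncidenceSet u).ConnectedComponent → ℝ) {β μ : ℝ} {x : V → ℝ} (hx : x ≠ 0)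
    (hsupp : ∀ y ∉ branch T u c, x y = 0)
    (heig : ∀ y ∈ branch T u c, (T.adjMatrix ℝ *ᵥ x) y = β * x y)
    (hμ : s ((T.deleteIncidenceSet u).connectedComponentMk c) * β +
      t ((T.deleteIncidenceSet u).connectedComponentMk c) = μ) :
    IsBranchVector T (branchMatrix T u s t) u c μ x := by
  refine ⟨hx, hsupp, fun y hyu => ?_⟩
  set K := (T.deleteIncidenceSet u).connectedComponentMk y with hK
  have h1 : (branchMatrix T u s t *ᵥ x) y = t K * x y + s K * (T.adjMatrix ℝ *ᵥ x) y := by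
    have h2 : ∀ z, branchMatrix T u s t y z * x z =
        (if y = z then t K * x z else 0) + s K * (T.adjMatrix ℝ y z * x z) := by
      intro z
      by_cases hzu : z = u
      · have : x z = 0 := hsupp z fun h => ne_of_mem_branch hc h hzu
        simp [this]
      · simp only [branchMatrix, Matrix.of_apply, SimpleGraph.adjMatrix_apply, hyu, hzu, or_self,
          if_false]
        by_cases hyz : y = z
        · subst hyz; simp [hK]
        · by_cases ha : T.Adj y z <;> simp [ha, hyz, hK]
    simp only [mulVec, dotProduct]
    rw [Finset.sum_congr rfl fun z _ => h2 z, Finset.sum_add_distrib, Finset.mul_sum,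
      Finset.sum_ite_eq, if_pos (Finset.mem_univ _)]
  rw [h1]
  by_cases hy : y ∈ branch T u c
  · rw [heig y hy, ← hμ, hK, mem_branch.1 hy]
    ring
  · rw [adjMatrix_mulVec_eq_zero hc hsupp hy hyu, hsupp y hy]
    ring

/-- All branches at a vertex of degree at least four can be given the eigenvalue `0`. -/
lemma exists_numEigenvalues_add_two_le_of_four_le {V : Type*} [Fintype V] [DecidableEq V]
    {T : SimpleGraph V} (hT : T.IsAcyclic) {u : V}
    (hu : 4 ≤ (T.neighborSet u).ncard) :
    ∃ A ∈ matrixClass T, numEigenvalues A + 2 ≤ Fintype.card V := by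
  classical
  have hB := T.isSymm_adjMatrix (α := ℝ)
  choose β x hx using fun K : (T.deleteIncidenceSet u).ConnectedComponent =>
    exists_eigenvector_on hB K.nonempty_supp
  refine ⟨branchMatrix T u 1 (-β), branchMatrix_mem_matrixClass T u (fun _ => one_ne_zero) _,
    numEigenvalues_add_two_le_of_three_le_finrank _ 0 ?_⟩
  have := ncard_neighborSet_le_finrank_add_one hT (branchMatrix T u 1 (-β)) u 0 fun c hc =>
    ⟨_, isBranchVector_branchMatrix (T.ne_of_adj hc).symm _ _ (hx _).1 (hx _).2.1 (hx _).2.2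
      (by simp)⟩
  omega

/-- If no neighbour of `u` is a leaf, every branch at `u` can be given both eigenvalues `0`
and `1`. -/
lemma exists_numEigenvalues_add_two_le_of_no_pendant {V : Type*} [Fintype V] [DecidableEq V]
    {T : SimpleGraph V} (hT : T.IsAcyclic) {u : V}
    (hu : 3 ≤ (T.neighborSet u).ncard) (h : ∀ c, T.Adj u c → ∃ z, z ≠ u ∧ T.Adj c z) :
    ∃ A ∈ matrixClass T, numEigenvalues A + 2 ≤ Fintype.card V := by
  classical
  have hB := T.isSymm_adjMatrix (α := ℝ)
  have key : ∀ K : (T.deleteIncidenceSet u).ConnectedComponent, ∃ s t : ℝ, s ≠ 0 ∧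
      ∀ c, T.Adj u c → (T.deleteIncidenceSet u).connectedComponentMk c = K → ∃ β γ : ℝ,
        s * β + t = 1 ∧ s * γ + t = 0 ∧
        (∃ x : V → ℝ, x ≠ 0 ∧ (∀ y ∉ branch T u c, x y = 0) ∧
          ∀ y ∈ branch T u c, (T.adjMatrix ℝ *ᵥ x) y = β * x y) ∧
        ∃ x : V → ℝ, x ≠ 0 ∧ (∀ y ∉ branch T u c, x y = 0) ∧
          ∀ y ∈ branch T u c, (T.adjMatrix ℝ *ᵥ x) y = γ * x y := by
    intro K
    by_cases hK : ∃ c, T.Adj u c ∧ (T.deleteIncidenceSet u).connectedComponentMk c = K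
    · obtain ⟨c, hc, rfl⟩ := hK
      obtain ⟨z, hzu, hz⟩ := h c hc
      have hzc : z ∈ branch T u c := (mk_eq_of_adj hz (T.ne_of_adj hc).symm hzu).symm
      obtain ⟨β, γ, hne, h1, h2⟩ := exists_two_eigenvectors_on hB (self_mem_branch T u c) hzc hz.ne
        (by simp [hz])
      have hne' : β - γ ≠ 0 := sub_ne_zero.2 hne
      refine ⟨1 / (β - γ), -γ / (β - γ), one_div_ne_zero hne', fun c' _ hcc' => ⟨β, γ, ?_, ?_, ?_⟩⟩
      · field_simp
        ring
      · field_simp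
        ring
      · rw [branch, hcc']
        exact ⟨h1, h2⟩
    -- A component without neighbours of `u`, such as `{u}`, is not constrained.
    · exact ⟨1, 0, one_ne_zero, fun c hc hcK => absurd ⟨c, hc, hcK⟩ hK⟩
  choose s t hs hst using key
  refine ⟨branchMatrix T u s t, branchMatrix_mem_matrixClass T u hs t,
    numEigenvalues_add_two_le_of_two_le_finrank _ (μ := 1) (ν := 0) one_ne_zero ?_ ?_⟩
  · have := ncard_neighborSet_le_finrank_add_one hT (branchMatrix T u s t) u 1 fun c hc => by
      obtain ⟨β, γ, h1, -, ⟨x, hx0, hx1, hx2⟩, -⟩ := hst _ c hc rfl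
      exact ⟨x, isBranchVector_branchMatrix (T.ne_of_adj hc).symm s t hx0 hx1 hx2 h1⟩
    omega
  · have := ncard_neighborSet_le_finrank_add_one hT (branchMatrix T u s t) u 0 fun c hc => by
      obtain ⟨β, γ, -, h1, -, ⟨x, hx0, hx1, hx2⟩⟩ := hst _ c hc rfl
      exact ⟨x, isBranchVector_branchMatrix (T.ne_of_adj hc).symm s t hx0 hx1 hx2 h1⟩
    omega

/-! ### Two branching vertices -/

open Classical in
lemma adjMatrix_add_diagonal_mem_matrixClass {V : Type*} [DecidableEq V] (T : SimpleGraph V)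
    (d : V → ℝ) :
    T.adjMatrix ℝ + diagonal d ∈ matrixClass T := by
  refine ⟨(T.isSymm_adjMatrix (α := ℝ)).add (isSymm_diagonal d), fun i j hij => ?_⟩
  simp [hij, SimpleGraph.adjMatrix_apply]

open Classical in
lemma adjMatrix_add_diagonal_mulVec_apply {V : Type*} [Fintype V] [DecidableEq V]
    (T : SimpleGraph V) (d x : V → ℝ) (y : V) :
    ((T.adjMatrix ℝ + diagonal d) *ᵥ x) y = (T.adjMatrix ℝ *ᵥ x) y + d y * x y := by
  rw [add_mulVec, Pi.add_apply, mulVec_diagonal]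

open Classical in
/-- Suppose that the diagonal `d` gives the eigenvalue `μ` to all branches at `u` not containing
`v`, and that `μ` is far from `d` on the rest of `T - u`, except possibly at `v`. Then a suitable
diagonal entry at `v` gives the eigenvalue `μ` also to the branch containing `v`, whatever the
diagonal entry at `u`. -/
lemma exists_diagonal_entry {V : Type*} [Fintype V] [DecidableEq V] {T : SimpleGraph V}
    (hT : T.IsAcyclic) {u v : V}
    {β : (T.deleteIncidenceSet u).ConnectedComponent → ℝ}
    (hβ : ∀ K, ∃ x : V → ℝ, x ≠ 0 ∧ (∀ y ∉ K.supp, x y = 0) ∧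
      ∀ y ∈ K.supp, (T.adjMatrix ℝ *ᵥ x) y = β K * x y)
    (d : V → ℝ) (μ : ℝ)
    (hout : ∀ y, y ≠ u → v ∉ branch T u y →
      d y = μ - β ((T.deleteIncidenceSet u).connectedComponentMk y))
    (hin : ∀ y, y ≠ u → y ≠ v → v ∈ branch T u y → (Fintype.card V : ℝ) < |d y - μ|)
    (huv : u ≠ v) :
    ∃ a : ℝ, ∀ d' : V → ℝ, (∀ y, y ≠ u → y ≠ v → d' y = d y) → d' v = a →
      (T.neighborSet u).ncard ≤
        finrank ℝ (End.eigenspace (T.adjMatrix ℝ + diagonal d').toLin' μ) + 1 := by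
  obtain ⟨x, hxv, hx0, hxe⟩ := exists_eigenvector_on_of_dominant (T.adjMatrix ℝ + diagonal d) μ
    (branch T u v \ {v}) (v := v) (by simp) (by
      rintro y ⟨hy, hyv⟩
      have hyu : y ≠ u := ne_of_mem_branch huv.symm hy
      have h1 := hin y hyu hyv (mem_branch.1 hy).symm
      have h2 : (T.adjMatrix ℝ + diagonal d) y y = d y := by simp
      rw [h2]
      refine lt_of_le_of_lt ?_ h1
      calc ∑ z ∈ Finset.univ.erase y, |(T.adjMatrix ℝ + diagonal d) y z|
          ≤ ∑ z ∈ Finset.univ.erase y, (1 : ℝ) := by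
            refine Finset.sum_le_sum fun z hz => ?_
            rw [Matrix.add_apply, diagonal_apply_ne _ (Finset.ne_of_mem_erase hz).symm, add_zero,
              SimpleGraph.adjMatrix_apply]
            split_ifs <;> simp
        _ ≤ ∑ z : V, (1 : ℝ) :=
            Finset.sum_le_sum_of_subset_of_nonneg (Finset.erase_subset _ _) fun _ _ _ => zero_le_one
        _ = Fintype.card V := by simp)
  refine ⟨μ - (T.adjMatrix ℝ *ᵥ x) v, fun d' hd' hd'v =>
    ncard_neighborSet_le_finrank_add_one hT _ u μ fun c hc => ?_⟩
  have hcu : c ≠ u := (T.ne_of_adj hc).symm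
  by_cases hvc : v ∈ branch T u c
  · have hbr : branch T u c = branch T u v := by rw [branch, branch, mem_branch.1 hvc]
    have hsupp : ∀ y ∉ branch T u c, x y = 0 := fun y hy =>
      hx0 y (fun h => hy (hbr ▸ h.1)) fun h => hy (h ▸ hvc)
    refine ⟨x, fun h => by simp [h] at hxv, hsupp, fun y hyu => ?_⟩
    rw [adjMatrix_add_diagonal_mulVec_apply]
    by_cases hy : y ∈ branch T u c
    -- The equation in row `v`, where `x v = 1`, is solved by the new diagonal entry.
    · by_cases hyv : y = v
      · subst hyv
        rw [hd'v, hxv]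
        ring
      · have := hxe y ⟨hbr ▸ hy, hyv⟩
        rw [adjMatrix_add_diagonal_mulVec_apply] at this
        rw [hd' y hyu hyv, this]
    · rw [adjMatrix_mulVec_eq_zero hcu hsupp hy hyu, hsupp y hy]
      ring
  · obtain ⟨x, hx, hsupp, heig⟩ := hβ ((T.deleteIncidenceSet u).connectedComponentMk c)
    refine ⟨x, hx, hsupp, fun y hyu => ?_⟩
    rw [adjMatrix_add_diagonal_mulVec_apply]
    by_cases hy : y ∈ branch T u c
    · have hvy : v ∉ branch T u y := fun h => hvc (h.trans hy)
      rw [heig y hy, hd' y hyu (fun e => hvc (e ▸ hy)), hout y hyu hvy, mem_branch.1 hy]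
      ring
    · rw [adjMatrix_mulVec_eq_zero hcu hsupp hy hyu, hsupp y hy]
      ring

/-- For two vertices `u ≠ v` of degree at least three, there is a matrix with two eigenvalues `L`
and `-L` that both have multiplicity at least two. -/
lemma exists_numEigenvalues_add_two_le_of_two_branching {V : Type*} [Fintype V] [DecidableEq V]
    {T : SimpleGraph V} (hT : T.IsTree)
    {u v : V} (huv : u ≠ v) (hu : 3 ≤ (T.neighborSet u).ncard)
    (hv : 3 ≤ (T.neighborSet v).ncard) :
    ∃ A ∈ matrixClass T, numEigenvalues A + 2 ≤ Fintype.card V := by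
  classical
  have hB := T.isSymm_adjMatrix (α := ℝ)
  choose β hβ using fun K : (T.deleteIncidenceSet u).ConnectedComponent =>
    exists_eigenvector_on hB K.nonempty_supp
  choose γ hγ using fun K : (T.deleteIncidenceSet v).ConnectedComponent =>
    exists_eigenvector_on hB K.nonempty_supp
  set b : V → ℝ := fun y => β ((T.deleteIncidenceSet u).connectedComponentMk y) with hb
  set g : V → ℝ := fun y => γ ((T.deleteIncidenceSet v).connectedComponentMk y) with hg
  -- The branches at `u` away from `v` get the eigenvalue `L`, the branches at `v` away from `u` get
  -- `-L`, and the part in between keeps the diagonal `0`; `L` dominates all other quantities.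
  -- The summand `1` makes the domination strict and `L ≠ -L`.
  set L : ℝ := Fintype.card V + ∑ y, |b y| + ∑ y, |g y| + 1 with hL
  have hbL : ∀ y, |b y| ≤ ∑ y, |b y| := fun y =>
    Finset.single_le_sum (f := fun y => |b y|) (fun _ _ => abs_nonneg _) (Finset.mem_univ y)
  have hgL : ∀ y, |g y| ≤ ∑ y, |g y| := fun y =>
    Finset.single_le_sum (f := fun y => |g y|) (fun _ _ => abs_nonneg _) (Finset.mem_univ y)
  have hb0 : 0 ≤ ∑ y, |b y| := Finset.sum_nonneg fun _ _ => abs_nonneg _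
  have hg0 : 0 ≤ ∑ y, |g y| := Finset.sum_nonneg fun _ _ => abs_nonneg _
  have hn0 : (0 : ℝ) ≤ Fintype.card V := Nat.cast_nonneg _
  set d : V → ℝ := fun y => if y ≠ u ∧ v ∉ branch T u y then L - b y
    else if y ≠ v ∧ u ∉ branch T v y then -L - g y else 0 with hd
  obtain ⟨a, ha⟩ := exists_diagonal_entry hT.isAcyclic hβ d L
    (fun y hyu hy => if_pos ⟨hyu, hy⟩)
    (fun y hyu hyv hy => by
      simp only [hd]
      rw [if_neg fun h => h.2 hy, lt_abs]
      split_ifs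
      · right
        have := neg_abs_le (g y)
        linarith [hgL y]
      · right
        linarith) huv
  obtain ⟨a', ha'⟩ := exists_diagonal_entry hT.isAcyclic hγ d (-L)
    -- No vertex lies both in a branch at `u` away from `v` and in a branch at `v` away from `u`, so
    -- the first case of `d` does not interfere here.
    (fun y hyv hy => by
      have : ¬ (y ≠ u ∧ v ∉ branch T u y) := fun h =>
        (mem_branch_or_mem_branch hT.connected huv h.1 hyv).elim h.2 hy
      simp only [hd]
      rw [if_neg this, if_pos ⟨hyv, hy⟩])
    (fun y hyv hyu hy => by
      simp only [hd]
      rw [lt_abs]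
      split_ifs with h1 h2
      · left
        have := le_abs_self (b y)
        linarith [hbL y]
      · exact absurd hy h2.2
      · left
        linarith) huv.symm
  set d' : V → ℝ := fun y => if y = v then a else if y = u then a' else d y with hd'
  have h1 := ha d' (fun y hyu hyv => by simp [hd', hyu, hyv]) (by simp [hd'])
  have h2 := ha' d' (fun y hyv hyu => by simp [hd', hyu, hyv]) (by simp [hd', huv])
  exact ⟨_, adjMatrix_add_diagonal_mem_matrixClass T d',
    numEigenvalues_add_two_le_of_two_le_finrank _ (μ := L) (ν := -L)
      (by intro h; linarith) (by omega) (by omega)⟩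

/-! ### Trees of maximum degree two -/

/-- A bijective numbering of the vertices by `0, ..., m - 1` such that adjacency means having
consecutive numbers. The values are natural numbers rather than elements of `Fin m`, to ease
arithmetic. -/
structure IsPathNumbering {V : Type*} (T : SimpleGraph V) (m : ℕ) (f : V → ℕ) : Prop where
  injective : Function.Injective f
  lt : ∀ y, f y < m
  surj : ∀ k < m, ∃ y, f y = k
  adj_iff : ∀ y z, T.Adj y z ↔ f y + 1 = f z ∨ f z + 1 = f y

lemma IsPathNumbering.nonempty_iso {V : Type*} {T : SimpleGraph V} {m : ℕ} {f : V → ℕ}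
    (hf : IsPathNumbering T m f) : Nonempty (T ≃g SimpleGraph.pathGraph m) := by
  let e : V ≃ Fin m := Equiv.ofBijective (fun y => ⟨f y, hf.lt y⟩)
    ⟨fun y z h => hf.injective (congrArg Fin.val h), fun k => by
      obtain ⟨y, hy⟩ := hf.surj k k.2
      exact ⟨y, Fin.ext hy⟩⟩
  refine ⟨⟨e, fun {y z} => ?_⟩⟩
  rw [SimpleGraph.pathGraph_adj, hf.adj_iff]
  rfl

lemma IsPathNumbering.reverse {V : Type*} {T : SimpleGraph V} {m : ℕ} {f : V → ℕ}
    (hf : IsPathNumbering T m f) : IsPathNumbering T m fun y => m - 1 - f y where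
  injective y z h := hf.injective (by have := hf.lt y; have := hf.lt z; simp only at h; omega)
  lt y := by have := hf.lt y; omega
  surj k hk := by
    obtain ⟨y, hy⟩ := hf.surj (m - 1 - k) (by omega)
    exact ⟨y, by omega⟩
  adj_iff y z := by
    have := hf.lt y
    have := hf.lt z
    rw [hf.adj_iff]
    omega

lemma image_neighborSet_induce_compl {V : Type*} (T : SimpleGraph V) (v : V)
    (w : ({v}ᶜ : Set V)) :
    Subtype.val '' (T.induce {v}ᶜ).neighborSet w = T.neighborSet w \ {v} := by
  ext y
  constructor
  · rintro ⟨z, hz, rfl⟩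
    exact ⟨hz, z.2⟩
  · rintro ⟨hy, hyv⟩
    exact ⟨⟨y, hyv⟩, hy, rfl⟩

lemma ncard_neighborSet_induce_compl {V : Type*} (T : SimpleGraph V) (v : V)
    (w : ({v}ᶜ : Set V)) :
    ((T.induce {v}ᶜ).neighborSet w).ncard = (T.neighborSet w \ {v}).ncard := by
  rw [← image_neighborSet_induce_compl, Set.ncard_image_of_injective _ Subtype.val_injective]

lemma isTree_induce_compl_of_neighborSet_eq {V : Type*} [Finite V] {T : SimpleGraph V}
    (hT : T.IsTree) {v w : V} (hv : T.neighborSet v = {w}) : (T.induce {v}ᶜ).IsTree := by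
  classical
  have := Fintype.ofFinite V
  refine ⟨hT.connected.induce_compl_singleton_of_degree_eq_one ?_, hT.isAcyclic.induce _⟩
  rw [← SimpleGraph.card_neighborSet_eq_degree, ← Set.toFinset_card,
    ← Set.ncard_eq_toFinset_card', hv, Set.ncard_singleton]

/-- Finite trees of maximum degree at most two are paths: remove a leaf and attach it to an end of
the numbering of the remaining tree. -/
lemma exists_isPathNumbering {V : Type*} [Fintype V] {T : SimpleGraph V} (hT : T.IsTree)
    (hdeg : ∀ v, (T.neighborSet v).ncard ≤ 2) {m : ℕ} (hm : Fintype.card V = m) :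
    ∃ f, IsPathNumbering T m f := by
  classical
  induction m generalizing V with
  | zero =>
    have := hT.connected.nonempty
    exact absurd hm Fintype.card_ne_zero
  | succ m ih =>
    obtain rfl | hm0 := Nat.eq_zero_or_pos m
    · have : Subsingleton V := Fintype.card_le_one_iff_subsingleton.1 hm.le
      obtain ⟨a⟩ := hT.connected.nonempty
      refine ⟨fun _ => 0, fun _ _ _ => Subsingleton.elim _ _, fun _ => one_pos,
        fun k hk => ⟨a, by omega⟩, fun y z => ?_⟩
      rw [Subsingleton.elim y z]
      simp
    have : Nontrivial V := Fintype.one_lt_card_iff_nontrivial.1 (by omega)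
    obtain ⟨v, hv⟩ := hT.exists_vert_degree_one_of_nontrivial
    rw [SimpleGraph.degree_eq_one_iff_existsUnique_adj] at hv
    obtain ⟨w, hvw, hw⟩ := hv
    simp only at hvw hw
    have hNv : T.neighborSet v = {w} := by
      ext y
      exact ⟨fun h => hw y h, fun h => by rw [Set.mem_singleton_iff.1 h]; exact hvw⟩
    have hwv : w ∈ ({v}ᶜ : Set V) := hvw.ne'
    have hcard : Fintype.card ({v}ᶜ : Set V) = m := by
      rw [Fintype.card_compl_set, hm]
      simp
    obtain ⟨g, hg⟩ := ih (V := ({v}ᶜ : Set V)) (isTree_induce_compl_of_neighborSet_eq hT hNv)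
      (fun y => by
        rw [ncard_neighborSet_induce_compl]
        exact (Set.ncard_le_ncard Set.sdiff_subset).trans (hdeg y)) hcard
    -- The neighbour of the leaf `v` is an end of the remaining path, as it has degree at most two.
    have hend : g ⟨w, hwv⟩ = 0 ∨ g ⟨w, hwv⟩ = m - 1 := by
      by_contra! h
      have hlt := hg.lt ⟨w, hwv⟩
      obtain ⟨y, hy⟩ := hg.surj (g ⟨w, hwv⟩ - 1) (by omega)
      obtain ⟨z, hz⟩ := hg.surj (g ⟨w, hwv⟩ + 1) (by omega)
      have hay : (T.induce {v}ᶜ).Adj ⟨w, hwv⟩ y := (hg.adj_iff _ _).2 (by omega)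
      have haz : (T.induce {v}ᶜ).Adj ⟨w, hwv⟩ z := (hg.adj_iff _ _).2 (by omega)
      have hyz : (y : V) ≠ z := fun e => by
        rw [Subtype.ext e] at hy
        omega
      have := (Set.two_lt_ncard_iff (Set.toFinite (T.neighborSet w))).2
        ⟨v, y, z, hvw.symm, hay, haz, (Ne.symm y.2 : v ≠ y), (Ne.symm z.2 : v ≠ z), hyz⟩
      exact absurd (hdeg w) (by omega)
    obtain ⟨g, hg, hgw⟩ : ∃ g, IsPathNumbering (T.induce {v}ᶜ) m g ∧ g ⟨w, hwv⟩ + 1 = m := by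
      rcases hend with h | h
      · exact ⟨_, hg.reverse, by simp only [h]; omega⟩
      · exact ⟨g, hg, by omega⟩
    refine ⟨fun y => if h : y = v then m else g ⟨y, h⟩, fun y z h => ?_, fun y => ?_, fun k hk =>
      ?_, fun y z => ?_⟩
    · by_cases hy : y = v <;> by_cases hz : z = v <;>
        simp only [hy, hz, dite_true, dite_false] at h ⊢
      · exact absurd h (hg.lt _).ne'
      · exact absurd h (hg.lt _).ne
      · exact congrArg Subtype.val (hg.injective h)
    · by_cases hy : y = v
      · simp [hy]
      · simp only [hy, dite_false]
        exact (hg.lt _).trans m.lt_succ_self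
    · by_cases hkm : k = m
      · exact ⟨v, by simp [hkm]⟩
      · obtain ⟨y, hy⟩ := hg.surj k (by omega)
        exact ⟨y, by simp only [show (y : V) ≠ v from y.2, dite_false]; exact hy⟩
    · have key : ∀ z, ∀ hz : z ∈ ({v}ᶜ : Set V), T.Adj v z ↔ g ⟨z, hz⟩ + 1 = m := by
        intro z hz
        constructor
        · intro h
          obtain rfl := hw z h
          exact hgw
        · intro h
          have : (⟨z, hz⟩ : ({v}ᶜ : Set V)) = ⟨w, hwv⟩ := hg.injective (by omega)
          rw [show z = w from congrArg Subtype.val this]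
          exact hvw
      by_cases hy : y = v
      · subst hy
        by_cases hz : z = y
        · subst hz
          simp
        · have := hg.lt ⟨z, hz⟩
          simp only [hz, dite_true, dite_false]
          rw [key z hz]
          omega
      · by_cases hz : z = v
        · subst hz
          have := hg.lt ⟨y, hy⟩
          simp only [hy, dite_true, dite_false]
          rw [T.adj_comm, key y hy]
          omega
        · simp only [hy, hz, dite_false]
          exact hg.adj_iff ⟨y, hy⟩ ⟨z, hz⟩

/-- An eigenvector of a matrix of a path is determined by its entry at an end of the path. -/
lemma IsPathNumbering.eq_zero_of_mulVec_eq_smul {V : Type*} [Fintype V] {T : SimpleGraph V} {m : ℕ}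
    {f : V → ℕ} (hf : IsPathNumbering T m f) {A : Matrix V V ℝ} (hA : A ∈ matrixClass T) {μ : ℝ}
    {x : V → ℝ} (hx : A *ᵥ x = μ • x) (h0 : ∀ y, f y = 0 → x y = 0) : x = 0 := by
  -- The equation in row `k - 1` determines the entry at `k` from the entries before it.
  have key : ∀ k, ∀ y, f y = k → x y = 0 := by
    intro k
    induction k using Nat.strong_induction_on with
    | _ k ih =>
      intro y hy
      rcases Nat.eq_zero_or_pos k with rfl | hk
      · exact h0 y hy
      obtain ⟨z, hz⟩ := hf.surj (k - 1) (by have := hf.lt y; omega)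
      have hxz : x z = 0 := ih (k - 1) (by omega) z hz
      have hrow := congrFun hx z
      have hzy : T.Adj z y := (hf.adj_iff z y).2 (by omega)
      rw [Pi.smul_apply, hxz, smul_zero, mulVec, dotProduct, Finset.sum_eq_single y] at hrow
      · exact (mul_eq_zero.1 hrow).resolve_left ((hA.2 z y hzy.ne).2 hzy)
      · intro t _ hty
        by_cases htz : t = z
        · rw [htz, hxz, mul_zero]
        by_cases ha : T.Adj z t
        · have h1 := (hf.adj_iff z t).1 ha
          have h2 : f t ≠ f y := fun e => hty (hf.injective e)
          rw [ih (f t) (by omega) t rfl, mul_zero]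
        · have : A z t = 0 := by
            by_contra h
            exact ha ((hA.2 z t (Ne.symm htz)).1 h)
          rw [this, zero_mul]
      · simp
  exact funext fun y => key _ y rfl

/-- All eigenvalues of a matrix of a path are simple. -/
lemma IsPathNumbering.numEigenvalues_eq {V : Type*} [Fintype V] [DecidableEq V]
    {T : SimpleGraph V} {m : ℕ} {f : V → ℕ} (hf : IsPathNumbering T m f) {A : Matrix V V ℝ}
    (hA : A ∈ matrixClass T) : numEigenvalues A = Fintype.card V := by
  have hH : A.IsHermitian := by
    rw [Matrix.IsHermitian, conjTranspose_eq_transpose_of_trivial]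
    exact hA.1
  have hinj : Function.Injective hH.eigenvalues := by
    intro i j hij
    by_contra hne
    obtain ⟨a, ha⟩ := hf.surj 0 (lt_of_le_of_lt (Nat.zero_le _) (hf.lt i))
    have hbasis : ∀ i, (hH.eigenvectorBasis i : V → ℝ) ≠ 0 := fun i h0 =>
      hH.eigenvectorBasis.orthonormal.ne_zero i (by ext k; exact congrFun h0 k)
    have ha0 : ∀ i, hH.eigenvectorBasis i a ≠ 0 := fun i h0 =>
      hbasis i (hf.eq_zero_of_mulVec_eq_smul hA (hH.mulVec_eigenvectorBasis i) fun y hy => by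
        rw [hf.injective (hy.trans ha.symm)]
        exact h0)
    -- The combination of the two eigenvectors that vanishes at the end `a` is zero, which
    -- contradicts their orthogonality.
    set x : V → ℝ := hH.eigenvectorBasis j a • (hH.eigenvectorBasis i : V → ℝ) -
      hH.eigenvectorBasis i a • (hH.eigenvectorBasis j : V → ℝ) with hx
    have hx0 : x = 0 := by
      refine hf.eq_zero_of_mulVec_eq_smul hA (μ := hH.eigenvalues i) ?_ fun y hy => ?_
      · rw [hx, mulVec_sub, mulVec_smul, mulVec_smul, hH.mulVec_eigenvectorBasis,
          hH.mulVec_eigenvectorBasis, ← hij, smul_sub, smul_comm,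
          smul_comm _ (hH.eigenvalues i) (hH.eigenvectorBasis j : V → ℝ)]
      · rw [hf.injective (hy.trans ha.symm), hx]
        simp [mul_comm]
    have heq : hH.eigenvectorBasis j a • hH.eigenvectorBasis i =
        hH.eigenvectorBasis i a • hH.eigenvectorBasis j := by
      ext y
      exact sub_eq_zero.1 (congrFun hx0 y)
    have hinner := congrArg (inner ℝ (hH.eigenvectorBasis i)) heq
    rw [inner_smul_right, inner_smul_right, hH.eigenvectorBasis.orthonormal.2 hne,
      real_inner_self_eq_norm_sq, hH.eigenvectorBasis.orthonormal.1 i] at hinner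
    exact ha0 j (by simpa using hinner)
  rw [numEigenvalues, hH.spectrum_real_eq_range_eigenvalues, ← Set.image_univ,
    Set.ncard_image_of_injective _ hinj, Set.ncard_univ, Nat.card_eq_fintype_card]

end DistinctEigenvalues

open DistinctEigenvalues in
theorem lemma7p4 {V : Type*} [Fintype V] [DecidableEq V] (T : SimpleGraph V)
    (hT : T.IsTree) (hq : DistinctEigenvalues.q T + 1 = Fintype.card V) :
    ∃ (v : V) (w : ({v}ᶜ : Set V)),
      Nonempty (T.induce {v}ᶜ ≃g SimpleGraph.pathGraph (Fintype.card V - 1)) ∧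
      DistinctEigenvalues.IsPendant T v ∧
      T.Adj v w ∧
      ¬ DistinctEigenvalues.IsPendant (T.induce {v}ᶜ) w := by
  classical
  have hbad : ¬ ∃ A ∈ matrixClass T, numEigenvalues A + 2 ≤ Fintype.card V := by
    rintro ⟨A, hA, h⟩
    have : q T ≤ numEigenvalues A := Nat.sInf_le ⟨A, hA, rfl⟩
    omega
  obtain ⟨A, hA, hAq⟩ : q T ∈ numEigenvalues '' matrixClass T :=
    Nat.sInf_mem ⟨_, _, adjMatrix_add_diagonal_mem_matrixClass T 0, rfl⟩
  obtain ⟨u, hu⟩ : ∃ u, 3 ≤ (T.neighborSet u).ncard := by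
    by_contra! h
    obtain ⟨f, hf⟩ := exists_isPathNumbering hT (fun v => Nat.le_of_lt_succ (h v)) rfl
    have := hf.numEigenvalues_eq hA
    omega
  have hu4 : ¬ 4 ≤ (T.neighborSet u).ncard := fun h =>
    hbad (exists_numEigenvalues_add_two_le_of_four_le hT.isAcyclic h)
  have hother : ∀ y, y ≠ u → (T.neighborSet y).ncard ≤ 2 := by
    intro y hy
    by_contra! h
    exact hbad (exists_numEigenvalues_add_two_le_of_two_branching hT hy h hu)
  obtain ⟨v, huv, hv⟩ : ∃ v, T.Adj u v ∧ ∀ z, T.Adj v z → z = u := by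
    by_contra! h
    refine hbad (exists_numEigenvalues_add_two_le_of_no_pendant hT.isAcyclic hu fun c hc => ?_)
    obtain ⟨z, hz, hzu⟩ := h c hc
    exact ⟨z, hzu, hz⟩
  have hNv : T.neighborSet v = {u} := by
    ext y
    exact ⟨fun h => hv y h, fun h => by rw [Set.mem_singleton_iff.1 h]; exact huv.symm⟩
  have hdeg_u : (T.neighborSet u \ {v}).ncard = 2 := by
    rw [Set.ncard_sdiff_singleton_of_mem (show v ∈ T.neighborSet u from huv)]
    omega
  obtain ⟨f, hf⟩ := exists_isPathNumbering (isTree_induce_compl_of_neighborSet_eq hT hNv)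
    (fun y => by
      rw [ncard_neighborSet_induce_compl]
      by_cases hy : (y : V) = u
      · rw [hy, hdeg_u]
      · exact (Set.ncard_le_ncard Set.sdiff_subset).trans (hother y hy))
    (m := Fintype.card V - 1) (by rw [Fintype.card_compl_set]; simp)
  refine ⟨v, ⟨u, huv.ne⟩, hf.nonempty_iso, ?_, huv.symm, ?_⟩
  · rw [IsPendant, hNv, Set.ncard_singleton]
  · rw [IsPendant, ncard_neighborSet_induce_compl, hdeg_u]
    decide
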